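/- Let $\mathcal{C}$ be the set of complex-valued continuous functions on $[0,\infty)$, made into a commutative ring without identity by pointwise addition and the convolution product $(ab)(t)=\int_0^t a(t-\sigma)b(\sigma)\,d\sigma$. By Titchmarsh's theorem $\mathcal{C}$ has no zero divisors; let $Q(\mathcal{C})$ be its quotient field, whose elements are the fractions $a/b$ with $a,b\in\mathcal{C}$, $b\neq 0$, and in which $\mathcal{C}$ is embedded by $a\mapsto (ac)/c$ for any $c\ne 0$. For a real number $q>0$ define $\tau_q\colon\mathcal{C}\to\mathcal{C}$ by $(\tau_q a)(t)=q\,a(qt)$. Then $\tau_q$ is a bijection of $\mathcal{C}$ satisfying $\tau_q(a+b)=\tau_q a+\tau_q b$ and $\tau_q(ab)=\tau_q(a)\,\tau_q(b)$ for all $a,b\in\mathcal{C}$, and $\tau_q b\neq 0$ whenever $b\neq 0$. The rule $$\tau\left(\frac{a}{b}\right)=\frac{\tau_q a}{\tau_q b}\qquad(a,b\in\mathcal{C},\ b\neq 0)$$ is well defined: if $a/b=c/d$ in $Q(\mathcal{C})$ with $b,d\ne 0$, then $\tau_q a/\tau_q b=\tau_q c/\tau_q d$. The unique map $\tau\colon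 Q(\mathcal{C})\to Q(\mathcal{C})$ given by this rule extends $\tau_q$, that is, $\tau(a)=\tau_q(a)$ for all $a\in\mathcal{C}$, and it is a field automorphism of $Q(\mathcal{C})$. -/

import Mathlib

namespace Mikusinski

section Analysis

open MeasureTheory Set intervalIntegral

lemma moment_real {p h : ℝ → ℝ} (hp : Continuous p) (hpi : Function.Injective p)
    (hh : Continuous h) {T : ℝ} (hT : 0 < T)
    (h0 : ∀ n : ℕ, ∫ x in (0 : ℝ)..T, p x ^ n * h x = 0) : ∀ x ∈ Icc 0 T, h x = 0 := by
  set A : Subalgebra ℝ C(ℝ, ℝ) := Algebra.adjoin ℝ {⟨p, hp⟩} with hA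
  have hAg : ∀ g ∈ A, ∫ x in (0 : ℝ)..T, g x * h x = 0 := by
    intro g hg
    have hg' : g ∈ Submodule.span ℝ (Submonoid.closure ({⟨p, hp⟩} : Set C(ℝ, ℝ)) : Set C(ℝ, ℝ)) := by
      rw [← Algebra.adjoin_eq_span]; exact hg
    induction hg' using Submodule.span_induction with
    | mem x hx =>
      obtain ⟨n, rfl⟩ := Submonoid.mem_closure_singleton.1 hx
      simpa using h0 n
    | zero => simp
    | add x y hx hy ihx ihy =>
      have hx' := ihx (by rw [hA, ← Subalgebra.mem_toSubmodule, Algebra.adjoin_eq_span]; exact hx)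
      have hy' := ihy (by rw [hA, ← Subalgebra.mem_toSubmodule, Algebra.adjoin_eq_span]; exact hy)
      simp only [ContinuousMap.add_apply, add_mul]
      rw [intervalIntegral.integral_add, hx', hy', add_zero]
      · exact Continuous.intervalIntegrable (by fun_prop) _ _
      · exact Continuous.intervalIntegrable (by fun_prop) _ _
    | smul a x hx ih =>
      have hx' := ih (by rw [hA, ← Subalgebra.mem_toSubmodule, Algebra.adjoin_eq_span]; exact hx)
      simp [mul_assoc, hx']
  have hsep : A.SeparatesPoints := fun x y hxy =>
    ⟨p, ⟨⟨p, hp⟩, Algebra.subset_adjoin rfl, rfl⟩, fun e => hxy (hpi e)⟩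
  have hle : ∫ x in (0 : ℝ)..T, h x * h x ≤ 0 := by
    set C := ∫ x in (0 : ℝ)..T, |h x| with hC
    have hC0 : 0 ≤ C := integral_nonneg hT.le fun _ _ => abs_nonneg _
    refine le_of_forall_pos_le_add fun ε hε => ?_
    obtain ⟨g, hgA, hg⟩ :=
      ContinuousMap.exists_mem_subalgebra_near_continuous_of_isCompact_of_separatesPoints
        hsep ⟨h, hh⟩ (isCompact_Icc (a := 0) (b := T)) (ε := ε / (C + 1)) (by positivity)
    have e1 : ∫ x in (0 : ℝ)..T, h x * h x = ∫ x in (0 : ℝ)..T, (h x * h x - g x * h x) := by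
      rw [intervalIntegral.integral_sub, hAg g hgA, sub_zero]
      · exact Continuous.intervalIntegrable (by fun_prop) _ _
      · exact Continuous.intervalIntegrable (by fun_prop) _ _
    have e2 : ∫ x in (0 : ℝ)..T, (h x * h x - g x * h x)
        ≤ ∫ x in (0 : ℝ)..T, ε / (C + 1) * |h x| := by
      refine integral_mono_on hT.le (Continuous.intervalIntegrable (by fun_prop) _ _)
        (Continuous.intervalIntegrable (by fun_prop) _ _) fun x hx => ?_
      have := hg x hx
      simp only [ContinuousMap.coe_mk, Real.norm_eq_abs] at this
      calc h x * h x - g x * h x = (h x - g x) * h x := by ring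
        _ ≤ |(h x - g x) * h x| := le_abs_self _
        _ = |g x - h x| * |h x| := by rw [abs_mul, abs_sub_comm]
        _ ≤ _ := by gcongr
    rw [e1]
    refine e2.trans ?_
    rw [intervalIntegral.integral_const_mul, ← hC, zero_add, div_mul_eq_mul_div, div_le_iff₀ (by positivity)]
    nlinarith
  intro x hx
  by_contra hne
  exact absurd hle (not_le.2 (integral_pos hT (by fun_prop) (fun y _ => mul_self_nonneg _)
    ⟨x, hx, mul_self_pos.2 hne⟩))

/-- A continuous function all of whose moments against the powers of an injective continuous
function vanish on an interval is zero there. -/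
lemma moment {p : ℝ → ℝ} {f : ℝ → ℂ} (hp : Continuous p) (hpi : Function.Injective p)
    (hf : Continuous f) {T : ℝ} (hT : 0 < T)
    (h0 : ∀ n : ℕ, ∫ x in (0 : ℝ)..T, (p x : ℂ) ^ n * f x = 0) : ∀ x ∈ Icc 0 T, f x = 0 := by
  have hint : ∀ n : ℕ, IntervalIntegrable (fun x => (p x : ℂ) ^ n * f x) volume 0 T := fun n =>
    Continuous.intervalIntegrable (by fun_prop) _ _
  intro x hx
  apply Complex.ext
  · refine moment_real hp hpi (h := fun x => (f x).re) (by fun_prop) hT (fun n => ?_) x hx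
    have := Complex.reCLM.intervalIntegral_comp_comm (hint n)
    rw [h0 n] at this
    simpa [← Complex.ofReal_pow] using this
  · refine moment_real hp hpi (h := fun x => (f x).im) (by fun_prop) hT (fun n => ?_) x hx
    have := Complex.imCLM.intervalIntegral_comp_comm (hint n)
    rw [h0 n] at this
    simpa [← Complex.ofReal_pow] using this

/-- Interchange of the order of integration over a triangle. -/
lemma integral_triangle {K : ℝ → ℝ → ℂ} (hK : Continuous K.uncurry) {t : ℝ} (ht : 0 ≤ t) :
    ∫ u in (0 : ℝ)..t, ∫ s in (0 : ℝ)..u, K u s = ∫ s in (0 : ℝ)..t, ∫ u in s..t, K u s := by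
  have hc1 : ∀ u, Continuous (K u) := fun u => hK.comp (by fun_prop : Continuous fun s => (u, s))
  have hc2 : ∀ s, Continuous fun u => K u s :=
    fun s => hK.comp (by fun_prop : Continuous fun u => (u, s))
  have e1 : ∀ u ∈ uIcc 0 t, ∫ s in (0 : ℝ)..u, K u s
      = ∫ s in (0 : ℝ)..t, ({p : ℝ × ℝ | p.2 ≤ p.1}.indicator K.uncurry) (u, s) := by
    intro u hu
    rw [uIcc_of_le ht] at hu
    rw [integral_of_le hu.1, integral_of_le ht]
    have : ∀ s, ({p : ℝ × ℝ | p.2 ≤ p.1}.indicator K.uncurry) (u, s) = (Iic u).indicator (K u) s := by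
      intro s; simp [indicator]
    simp_rw [this]
    rw [setIntegral_indicator measurableSet_Iic]
    congr 2
    ext s; simp only [mem_Ioc, mem_inter_iff, mem_Iic]
    exact ⟨fun h => ⟨⟨h.1, h.2.trans hu.2⟩, h.2⟩, fun h => ⟨h.1.1, h.2⟩⟩
  have e2 : ∀ s ∈ uIcc 0 t, ∫ u in s..t, K u s
      = ∫ u in (0 : ℝ)..t, ({p : ℝ × ℝ | p.2 ≤ p.1}.indicator K.uncurry) (u, s) := by
    intro s hs
    rw [uIcc_of_le ht] at hs
    rw [integral_of_le hs.2, integral_of_le ht]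
    have : ∀ u, ({p : ℝ × ℝ | p.2 ≤ p.1}.indicator K.uncurry) (u, s)
        = (Ici s).indicator (fun u => K u s) u := by
      intro s; simp [indicator]
    simp_rw [this]
    rw [setIntegral_indicator measurableSet_Ici]
    have : (Ioc 0 t ∩ Ici s : Set ℝ) =ᵐ[volume] Ioc s t := by
      refine (Filter.EventuallyEq.inter (Filter.EventuallyEq.rfl) Ioi_ae_eq_Ici.symm).trans ?_
      refine Filter.EventuallyEq.of_eq (?_ : (Ioc 0 t ∩ Ioi s : Set ℝ) = Ioc s t)
      ext u; simp only [mem_Ioc, mem_inter_iff, mem_Ioi]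
      exact ⟨fun h => ⟨h.2, h.1.2⟩, fun h => ⟨⟨hs.1.trans_lt h.1, h.2⟩, h.1⟩⟩
    rw [Measure.restrict_congr_set this]
  rw [integral_congr e1, integral_congr e2]
  refine intervalIntegral_intervalIntegral_swap
    (F := fun u s => ({p : ℝ × ℝ | p.2 ≤ p.1}.indicator K.uncurry) (u, s)) ?_
  have : IntegrableOn K.uncurry (uIcc 0 t ×ˢ uIcc 0 t) volume :=
    hK.continuousOn.integrableOn_compact (isCompact_uIcc.prod isCompact_uIcc)
  exact (this.mono_set (prod_mono uIoc_subset_uIcc uIoc_subset_uIcc)).indicator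
    (measurableSet_le measurable_snd measurable_fst)

/-- Convolution on the half line of functions given on the whole line. -/
noncomputable def convR (f g : ℝ → ℂ) (t : ℝ) : ℂ := ∫ s in (0 : ℝ)..t, f (t - s) * g s

lemma continuous_convR {f g : ℝ → ℂ} (hf : Continuous f) (hg : Continuous g) :
    Continuous (convR f g) := by
  unfold convR
  exact continuous_parametric_intervalIntegral_of_continuous
    (f := fun t s => f (t - s) * g s) (by fun_prop) continuous_id

lemma convR_comm (f g : ℝ → ℂ) (t : ℝ) : convR f g t = convR g f t := by
  have := integral_comp_sub_left (fun s => g (t - s) * f s) t (a := 0) (b := t)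
  simp only [sub_self, sub_zero, sub_sub_cancel] at this
  unfold convR
  rw [integral_congr (g := fun s => g s * f (t - s)) fun s _ => mul_comm _ _, this]

lemma convR_assoc {f g h : ℝ → ℂ} (hf : Continuous f) (hg : Continuous g) (hh : Continuous h)
    {t : ℝ} (ht : 0 ≤ t) : convR (convR f g) h t = convR f (convR g h) t := by
  have e := integral_triangle (K := fun u s => f (t - u) * (g (u - s) * h s)) (by fun_prop) ht
  calc convR (convR f g) h t
      = ∫ s in (0 : ℝ)..t, ∫ u in s..t, f (t - u) * (g (u - s) * h s) := by
        refine integral_congr fun s _ => ?_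
        have := integral_comp_sub_right (fun u => f (t - s - u) * (g u * h s)) s (a := s) (b := t)
        simp only [sub_self] at this
        simp only [convR, ← intervalIntegral.integral_mul_const, mul_assoc]
        rw [← this]
        refine integral_congr fun u _ => ?_
        rw [show t - s - (u - s) = t - u by ring]
    _ = _ := e.symm
    _ = convR f (convR g h) t := by
        refine integral_congr fun s _ => ?_
        simp only [convR, ← intervalIntegral.integral_const_mul]


/-- The convolution square is injective at zero. -/
lemma convR_self_eq_zero {f : ℝ → ℂ} (hf : Continuous f) (h : ∀ t, 0 ≤ t → convR f f t = 0) :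
    ∀ t, 0 ≤ t → f t = 0 := by
  intro t ht
  obtain ⟨T, hT, htT⟩ : ∃ T : ℝ, 0 < T ∧ t < T := ⟨t + 1, by linarith, by linarith⟩
  obtain ⟨A, hA⟩ := (isCompact_Icc (a := (0 : ℝ)) (b := 2 * T)).exists_bound_of_continuousOn
    hf.continuousOn
  have hA0 : 0 ≤ A := (norm_nonneg _).trans (hA 0 ⟨le_rfl, by linarith⟩)
  set F : ℂ → ℂ := fun z => ∫ s in (0 : ℝ)..T, Complex.exp (z * ((T - s : ℝ) : ℂ)) * f s with hF
  have hpos : ∀ z : ℂ, 0 ≤ z.re → ‖F z‖ ≤ 3 * T * A := by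
    intro z hz
    set φ : ℝ → ℂ := fun s => Complex.exp (-z * (s : ℂ)) * f s with hφ
    have hφc : Continuous φ := by fun_prop
    have hφi : ∀ a b, IntervalIntegrable φ volume a b := fun a b => hφc.intervalIntegrable _ _
    have hφn : ∀ s, ‖φ s‖ = Real.exp (-(z.re * s)) * ‖f s‖ := by
      intro s; simp [hφ, Complex.norm_exp]
    have hφφ : ∀ u, 0 ≤ u → convR φ φ u = 0 := by
      intro u hu
      have : convR φ φ u = Complex.exp (-z * u) * convR f f u := by
        simp only [convR, ← intervalIntegral.integral_const_mul, hφ]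
        refine integral_congr fun s _ => ?_
        have : Complex.exp (-z * (u : ℂ))
            = Complex.exp (-z * ((u - s : ℝ) : ℂ)) * Complex.exp (-z * (s : ℂ)) := by
          rw [← Complex.exp_add]; congr 1; push_cast; ring
        rw [this]; ring
      rw [this, h u hu, mul_zero]
    set Φ : ℝ → ℂ := fun x => ∫ s in (0 : ℝ)..x, φ s with hΦ
    have hΦc : Continuous Φ := continuous_primitive hφi 0
    have hΦφ : ∫ s in (0 : ℝ)..(2 * T), Φ (2 * T - s) * φ s = 0 := by
      have e := convR_assoc (f := fun _ => 1) (g := φ) (h := φ) continuous_const hφc hφc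
        (t := 2 * T) (by linarith)
      have e1 : convR (fun _ => 1) φ = Φ := by
        funext x; simp [convR, hΦ]
      have e2 : convR (fun _ => 1) (convR φ φ) (2 * T) = 0 := by
        simp only [convR, one_mul]
        rw [integral_congr (g := fun _ => (0 : ℂ))]
        · simp
        · intro s hs
          rw [uIcc_of_le (by linarith)] at hs
          exact hφφ s hs.1
      rw [e1, e2] at e
      exact e
    have hsq : Φ (2 * T) * Φ (2 * T)
        = ∫ s in (0 : ℝ)..(2 * T), (Φ (2 * T) - Φ (2 * T - s)) * φ s := by
      simp only [sub_mul]
      rw [intervalIntegral.integral_sub, hΦφ, sub_zero, intervalIntegral.integral_const_mul]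
      · exact Continuous.intervalIntegrable (by fun_prop) _ _
      · exact Continuous.intervalIntegrable (by fun_prop) _ _
    set E := Real.exp (-(z.re * T)) with hE
    have hE0 : 0 < E := Real.exp_pos _
    have hb : ‖Φ (2 * T) * Φ (2 * T)‖ ≤ (2 * T * A * E) ^ 2 := by
      rw [hsq]
      have hk : ∀ s ∈ uIoc 0 (2 * T), ‖(Φ (2 * T) - Φ (2 * T - s)) * φ s‖ ≤ 2 * T * (A * E) ^ 2 := by
        intro s hs
        rw [uIoc_of_le (by linarith)] at hs
        have d : Φ (2 * T) - Φ (2 * T - s) = ∫ r in (2 * T - s)..(2 * T), φ r :=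
          integral_interval_sub_left (hφi _ _) (hφi _ _)
        have b1 : ‖∫ r in (2 * T - s)..(2 * T), φ r‖
            ≤ (Real.exp (-(z.re * (2 * T - s))) * A) * |2 * T - (2 * T - s)| := by
          refine norm_integral_le_of_norm_le_const fun r hr => ?_
          rw [uIoc_of_le (by linarith [hs.1])] at hr
          rw [hφn]
          have := hA r ⟨by linarith [hr.1, hs.2], hr.2⟩
          have : z.re * (2 * T - s) ≤ z.re * r := mul_le_mul_of_nonneg_left hr.1.le hz
          gcongr
        have b2 : ‖φ s‖ ≤ Real.exp (-(z.re * s)) * A := by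
          rw [hφn]
          have := hA s ⟨hs.1.le, hs.2⟩
          gcongr
        have b3 : |2 * T - (2 * T - s)| ≤ 2 * T := by
          rw [sub_sub_cancel, abs_of_pos hs.1]; exact hs.2
        have b4 : Real.exp (-(z.re * (2 * T - s))) * Real.exp (-(z.re * s)) = E ^ 2 := by
          rw [hE, ← Real.exp_add, sq, ← Real.exp_add]; congr 1; ring
        rw [norm_mul, d]
        calc _ ≤ (Real.exp (-(z.re * (2 * T - s))) * A * (2 * T)) * (Real.exp (-(z.re * s)) * A) := by
              gcongr
              exact b1.trans (by gcongr)
          _ = 2 * T * A ^ 2 *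
              (Real.exp (-(z.re * (2 * T - s))) * Real.exp (-(z.re * s))) := by ring
          _ = _ := by rw [b4]; ring
      refine (norm_integral_le_of_norm_le_const hk).trans (le_of_eq ?_)
      rw [sub_zero, abs_of_pos (by linarith)]; ring
    have hb' : ‖Φ (2 * T)‖ ≤ 2 * T * A * E := by
      rw [norm_mul, ← sq] at hb
      exact le_of_sq_le_sq hb (by positivity)
    have hc : ‖∫ s in T..(2 * T), φ s‖ ≤ (E * A) * |2 * T - T| := by
      refine norm_integral_le_of_norm_le_const fun r hr => ?_
      rw [uIoc_of_le (by linarith)] at hr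
      rw [hφn]
      have := hA r ⟨by linarith [hr.1], hr.2⟩
      have : z.re * T ≤ z.re * r := mul_le_mul_of_nonneg_left hr.1.le hz
      rw [hE]
      gcongr
    have hd : Φ T = Φ (2 * T) - ∫ s in T..(2 * T), φ s := by
      rw [eq_sub_iff_add_eq]; exact integral_add_adjacent_intervals (hφi _ _) (hφi _ _)
    have hFΦ : F z = Complex.exp (z * T) * Φ T := by
      simp only [hF, hΦ, hφ, ← intervalIntegral.integral_const_mul]
      refine integral_congr fun s _ => ?_
      rw [← mul_assoc, ← Complex.exp_add]
      congr 2; push_cast; ring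
    have hET : Real.exp (z.re * T) * E = 1 := by
      rw [hE, ← Real.exp_add]; simp
    rw [hFΦ, norm_mul, Complex.norm_exp]
    have hre : (z * (T : ℂ)).re = z.re * T := by simp
    rw [hre, hd]
    calc Real.exp (z.re * T) * ‖Φ (2 * T) - ∫ s in T..(2 * T), φ s‖
        ≤ Real.exp (z.re * T) * (2 * T * A * E + E * A * |2 * T - T|) := by
          gcongr
          exact (norm_sub_le _ _).trans (add_le_add hb' hc)
      _ = (Real.exp (z.re * T) * E) * (3 * T * A) := by
          rw [show 2 * T - T = T by ring, abs_of_pos hT]; ring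
      _ = 3 * T * A := by rw [hET, one_mul]
  have hneg : ∀ z : ℂ, z.re ≤ 0 → ‖F z‖ ≤ 3 * T * A := by
    intro z hz
    have : ‖F z‖ ≤ A * |T - 0| := by
      refine norm_integral_le_of_norm_le_const fun r hr => ?_
      rw [uIoc_of_le hT.le] at hr
      have h1 : ‖Complex.exp (z * ((T - r : ℝ) : ℂ))‖ ≤ 1 := by
        rw [Complex.norm_exp, Real.exp_le_one_iff, Complex.re_mul_ofReal]
        exact mul_nonpos_of_nonpos_of_nonneg hz (by linarith [hr.2])
      rw [norm_mul]
      calc _ ≤ 1 * A := by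
            gcongr
            exact hA r ⟨hr.1.le, by linarith [hr.2]⟩
        _ = A := one_mul A
    rw [sub_zero, abs_of_pos hT] at this
    nlinarith [mul_nonneg hT.le hA0]
  have hdiff : Differentiable ℂ F := by
    intro z
    have hcont : Continuous (fun q : ℂ × ℝ =>
        Complex.exp (q.1 * ((T - q.2 : ℝ) : ℂ)) * ((T - q.2 : ℝ) : ℂ) * f q.2) := by fun_prop
    obtain ⟨B, hB⟩ := ((isCompact_closedBall z 1).prod
      (isCompact_uIcc (a := (0 : ℝ)) (b := T))).exists_bound_of_continuousOn hcont.continuousOn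
    refine (hasDerivAt_integral_of_dominated_loc_of_deriv_le (𝕜 := ℂ) (a := 0) (b := T)
      (F := fun z s => Complex.exp (z * ((T - s : ℝ) : ℂ)) * f s)
      (F' := fun z s => Complex.exp (z * ((T - s : ℝ) : ℂ)) * ((T - s : ℝ) : ℂ) * f s)
      (bound := fun _ => B) (Metric.closedBall_mem_nhds z one_pos) ?_ ?_ ?_ ?_ ?_ ?_).2.differentiableAt
    · exact Filter.Eventually.of_forall fun w =>
        (by fun_prop : Continuous fun s : ℝ =>
          Complex.exp (w * ((T - s : ℝ) : ℂ)) * f s).aestronglyMeasurable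
    · exact Continuous.intervalIntegrable (by fun_prop) _ _
    · exact (by fun_prop : Continuous fun s : ℝ =>
          Complex.exp (z * ((T - s : ℝ) : ℂ)) * ((T - s : ℝ) : ℂ) * f s).aestronglyMeasurable
    · exact Filter.Eventually.of_forall fun s hs w hw => hB (w, s) ⟨hw, uIoc_subset_uIcc hs⟩
    · exact continuous_const.intervalIntegrable _ _
    · refine Filter.Eventually.of_forall fun s _ w _ => ?_
      have := ((hasDerivAt_id w).mul_const ((T - s : ℝ) : ℂ)).cexp.mul_const (f s)
      simpa using this
  have hbdd : Bornology.IsBounded (range F) := by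
    refine isBounded_iff_forall_norm_le.2 ⟨3 * T * A, ?_⟩
    rintro _ ⟨z, rfl⟩
    exact (le_total 0 z.re).elim (hpos z) (hneg z)
  have hconst := fun z w => hdiff.apply_eq_apply_of_bounded hbdd z w
  have hm := moment (p := fun s => Real.exp (T - s))
    (f := fun s => (Complex.exp ((T - s : ℝ) : ℂ) - 1) * f s) (by fun_prop)
    (fun a b hab => by
      have := Real.exp_injective hab
      linarith) (by fun_prop) hT (fun n => ?_) t ⟨ht, htT.le⟩
  · refine (mul_eq_zero.1 hm).resolve_left ?_
    rw [← Complex.ofReal_exp, sub_eq_zero]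
    intro h1
    have h1' : Real.exp (T - t) = 1 := by exact_mod_cast h1
    rw [Real.exp_eq_one_iff] at h1'
    linarith
  · have e : F (n + 1) - F n = 0 := sub_eq_zero.2 (hconst _ _)
    rw [hF] at e
    simp only at e
    rw [← intervalIntegral.integral_sub] at e
    · rw [← e]
      refine integral_congr fun s _ => ?_
      rw [add_mul, Complex.exp_add, one_mul, Complex.ofReal_exp, ← Complex.exp_nat_mul]
      ring
    · exact Continuous.intervalIntegrable (by fun_prop) _ _
    · exact Continuous.intervalIntegrable (by fun_prop) _ _

/-- **Titchmarsh's theorem**: convolution on the half line has no zero divisors. -/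
lemma titchmarsh {f g : ℝ → ℂ} (hf : Continuous f) (hg : Continuous g)
    (h : ∀ t, 0 ≤ t → convR f g t = 0) :
    (∀ t, 0 ≤ t → f t = 0) ∨ (∀ t, 0 ≤ t → g t = 0) := by
  have congrL : ∀ {a a' b : ℝ → ℂ}, (∀ t, 0 ≤ t → a t = a' t) → ∀ t, 0 ≤ t →
      convR a b t = convR a' b t := by
    intro a a' b haa t ht
    refine integral_congr fun s hs => ?_
    rw [uIcc_of_le ht] at hs
    simp only [haa (t - s) (by linarith [hs.2])]
  have zeroL : ∀ {a b : ℝ → ℂ}, (∀ t, 0 ≤ t → a t = 0) → ∀ t, 0 ≤ t → convR a b t = 0 := by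
    intro a b ha t ht
    rw [congrL (a' := fun _ => 0) ha t ht]; simp [convR]
  set X : (ℝ → ℂ) → ℝ → ℂ := fun a s => (s : ℂ) * a s with hX
  -- multiplication by the variable is a derivation for convolution
  have step : ∀ {b : ℝ → ℂ}, Continuous b → (∀ t, 0 ≤ t → convR f b t = 0) →
      ∀ t, 0 ≤ t → convR f (X b) t = 0 := by
    intro b hb hfb
    have hXf : Continuous (X f) := by fun_prop
    have hXb : Continuous (X b) := by fun_prop
    have hfX : Continuous (convR f (X b)) := continuous_convR hf hXb
    have hder : ∀ t, 0 ≤ t → convR f (X b) t = - convR (X f) b t := by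
      intro t ht
      rw [eq_neg_iff_add_eq_zero]
      have : (t : ℂ) * convR f b t = convR f (X b) t + convR (X f) b t := by
        simp only [convR, ← intervalIntegral.integral_const_mul]
        rw [← intervalIntegral.integral_add]
        · refine integral_congr fun s _ => ?_
          simp only [hX]; push_cast; ring
        · exact Continuous.intervalIntegrable (by fun_prop) _ _
        · exact Continuous.intervalIntegrable (by fun_prop) _ _
      rw [← this, hfb t ht, mul_zero]
    refine convR_self_eq_zero hfX fun t ht => ?_
    have e1 : convR (convR f (X b)) (convR f (X b)) t
        = convR (fun t => - convR (X f) b t) (convR f (X b)) t := congrL hder t ht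
    have e2 : convR (fun t => - convR (X f) b t) (convR f (X b)) t
        = - convR (convR (X f) b) (convR f (X b)) t := by
      simp [convR]
    have e3 : convR (convR (X f) b) (convR f (X b)) t
        = convR (convR (convR (X f) b) f) (X b) t :=
      (convR_assoc (continuous_convR hXf hb) hf hXb ht).symm
    have e4 : convR (convR (convR (X f) b) f) (X b) t = 0 := by
      refine zeroL (fun u hu => ?_) t ht
      rw [convR_assoc hXf hb hf hu, convR_comm]
      refine zeroL (fun v hv => ?_) u hu
      rw [convR_comm, hfb v hv]
    rw [e1, e2, e3, e4, neg_zero]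
  have hall : ∀ n : ℕ, ∀ t, 0 ≤ t → convR f (fun s => (s : ℂ) ^ n * g s) t = 0 := by
    intro n
    induction n with
    | zero => simpa using h
    | succ n ih =>
      have := step (b := fun s => (s : ℂ) ^ n * g s) (by fun_prop) ih
      have e : X (fun s : ℝ => (s : ℂ) ^ n * g s) = fun s : ℝ => (s : ℂ) ^ (n + 1) * g s := by
        funext s; simp only [hX]; ring
      rwa [e] at this
  have hprod : ∀ T : ℝ, 0 < T → ∀ s ∈ Icc 0 T, f (T - s) * g s = 0 := fun T hT =>
    moment (p := fun s => s) (f := fun s => f (T - s) * g s) (by fun_prop)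
      (fun _ _ h => h) (by fun_prop) hT fun n => by
        have := hall n T hT.le
        simp only [convR] at this
        rw [← this]
        refine integral_congr fun s _ => ?_
        ring
  have h00 : ∀ t ∈ Ici (0 : ℝ), f t * g 0 = 0 := by
    have hcl : IsClosed {t : ℝ | f t * g 0 = 0} := isClosed_eq (by fun_prop) continuous_const
    have hsub : Ioi (0 : ℝ) ⊆ {t : ℝ | f t * g 0 = 0} := fun t ht => by
      simpa using hprod t ht 0 ⟨le_rfl, le_of_lt ht⟩
    have := hcl.closure_subset_iff.2 hsub
    rwa [closure_Ioi] at this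
  by_contra hcon
  push Not at hcon
  obtain ⟨⟨a, ha, hfa⟩, ⟨b, hb, hgb⟩⟩ := hcon
  rcases hb.eq_or_lt with rfl | hb'
  · exact mul_ne_zero hfa hgb (h00 a ha)
  · have := hprod (a + b) (by linarith) b ⟨hb, by linarith⟩
    rw [add_sub_cancel_right] at this
    exact mul_ne_zero hfa hgb this

end Analysis

open scoped NNReal

/-- The set of complex-valued continuous functions on the half line `[0, ∞)`; its multiplication
(defined below) is convolution, not the pointwise product. -/
def ConvRing : Type := C(ℝ≥0, ℂ)

namespace ConvRing

instance : FunLike ConvRing ℝ≥0 ℂ := inferInstanceAs (FunLike C(ℝ≥0, ℂ) ℝ≥0 ℂ)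

instance : ContinuousMapClass ConvRing ℝ≥0 ℂ :=
  inferInstanceAs (ContinuousMapClass C(ℝ≥0, ℂ) ℝ≥0 ℂ)

/-- A continuous function on the half line as an element of the ring. -/
def mk (f : ℝ≥0 → ℂ) (hf : Continuous f) : ConvRing := (⟨f, hf⟩ : C(ℝ≥0, ℂ))

@[simp] lemma mk_apply (f : ℝ≥0 → ℂ) (hf : Continuous f) (t : ℝ≥0) : mk f hf t = f t := rfl

@[ext] lemma ext {a b : ConvRing} (h : ∀ t, a t = b t) : a = b := DFunLike.ext _ _ h

/-- Addition is pointwise. -/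
noncomputable instance : AddCommGroup ConvRing := inferInstanceAs (AddCommGroup C(ℝ≥0, ℂ))

@[simp] lemma add_apply (a b : ConvRing) (t : ℝ≥0) : (a + b) t = a t + b t := rfl

@[simp] lemma zero_apply (t : ℝ≥0) : (0 : ConvRing) t = 0 := rfl

/-- Extension of a function on the half line to the whole line, constant on the negative axis. -/
def extend (a : ConvRing) (t : ℝ) : ℂ := a t.toNNReal

@[fun_prop] lemma continuous_extend (a : ConvRing) : Continuous a.extend :=
  (map_continuous a).comp continuous_real_toNNReal

/-- Multiplication is convolution, `(a * b) t = ∫ τ in 0..t, a (t - τ) * b τ`. -/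
noncomputable instance : Mul ConvRing where
  mul a b := mk (fun t => ∫ τ in (0 : ℝ)..t, a ((t : ℝ) - τ).toNNReal * b τ.toNNReal)
    ((continuous_convR a.continuous_extend b.continuous_extend).comp NNReal.continuous_coe)

lemma mul_apply (a b : ConvRing) (t : ℝ≥0) :
    (a * b) t = ∫ τ in (0 : ℝ)..t, a ((t : ℝ) - τ).toNNReal * b τ.toNNReal := rfl

lemma mul_eq_convR (a b : ConvRing) (t : ℝ≥0) : (a * b) t = convR a.extend b.extend t := rfl

lemma extend_mul (a b : ConvRing) {t : ℝ} (ht : 0 ≤ t) :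
    (a * b).extend t = convR a.extend b.extend t := by
  rw [extend, mul_eq_convR, Real.coe_toNNReal t ht]

protected lemma mul_comm (a b : ConvRing) : a * b = b * a :=
  ext fun t => by rw [mul_eq_convR, mul_eq_convR, convR_comm]

protected lemma mul_assoc (a b c : ConvRing) : a * b * c = a * (b * c) := by
  ext t
  have h1 : convR (a * b).extend c.extend t = convR (convR a.extend b.extend) c.extend t := by
    refine intervalIntegral.integral_congr fun s hs => ?_
    rw [Set.uIcc_of_le (NNReal.coe_nonneg t)] at hs
    simp only [extend_mul a b (sub_nonneg.2 hs.2)]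
  have h2 : convR a.extend (b * c).extend t = convR a.extend (convR b.extend c.extend) t := by
    refine intervalIntegral.integral_congr fun s hs => ?_
    rw [Set.uIcc_of_le (NNReal.coe_nonneg t)] at hs
    simp only [extend_mul b c hs.1]
  rw [mul_eq_convR, mul_eq_convR, h1, h2]
  exact convR_assoc a.continuous_extend b.continuous_extend c.continuous_extend t.2

protected lemma add_mul (a b c : ConvRing) : (a + b) * c = a * c + b * c := by
  ext t
  have h : (a + b).extend = fun s => a.extend s + b.extend s := rfl
  simp only [add_apply, mul_eq_convR, convR, h, add_mul]
  exact intervalIntegral.integral_add (Continuous.intervalIntegrable (by fun_prop) _ _)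
    (Continuous.intervalIntegrable (by fun_prop) _ _)

protected lemma zero_mul (a : ConvRing) : 0 * a = 0 := by
  ext t
  simp [mul_apply]

/-- The convolution ring: a commutative ring without identity. -/
noncomputable instance : NonUnitalCommRing ConvRing where
  left_distrib a b c := by
    rw [ConvRing.mul_comm, ConvRing.add_mul, ConvRing.mul_comm b, ConvRing.mul_comm c]
  right_distrib := ConvRing.add_mul
  zero_mul := ConvRing.zero_mul
  mul_zero a := by rw [ConvRing.mul_comm, ConvRing.zero_mul]
  mul_assoc := ConvRing.mul_assoc
  mul_comm := ConvRing.mul_comm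

instance : NoZeroDivisors ConvRing where
  eq_zero_or_eq_zero_of_mul_eq_zero {a b} h := by
    have key := titchmarsh a.continuous_extend b.continuous_extend fun t ht => by
      rw [← extend_mul a b ht, h]; rfl
    have back : ∀ c : ConvRing, (∀ t, 0 ≤ t → c.extend t = 0) → c = 0 := fun c hc =>
      ext fun t => by simpa [extend] using hc t t.2
    exact key.imp (back a) (back b)

instance : Nontrivial ConvRing :=
  ⟨mk (fun _ => 1) continuous_const, 0, fun h =>
    one_ne_zero (α := ℂ) (DFunLike.congr_fun h (0 : ℝ≥0))⟩

/-- The map `τ_q`, sending the function `a(t)` to the function `q a(qt)`. -/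
def tau (q : ℝ) (_hq : 0 < q) (a : ConvRing) : ConvRing :=
  mk (fun t => (q : ℂ) * a (q.toNNReal * t)) <|
    continuous_const.mul ((map_continuous a).comp (continuous_const.mul continuous_id))

end ConvRing

/-! ### The quotient field of a commutative ring without zero divisors

The ring need not have an identity. -/

section QuotientField

variable (R : Type*) [NonUnitalCommRing R] [NoZeroDivisors R]

/-- Pairs `(a, b)` with `b ≠ 0`, where `(a, b)` and `(c, d)` are identified if `a d = b c`. -/
def fracSetoid : Setoid (R × {b : R // b ≠ 0}) where
  r x y := x.1 * y.2 = x.2 * y.1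
  iseqv :=
    { refl := fun x => mul_comm _ _
      symm := fun {x y} h => by rw [mul_comm y.1, mul_comm (y.2 : R)]; exact h.symm
      trans := fun {x y z} h1 h2 => by
        have h : (y.2 : R) * (x.1 * z.2 - x.2 * z.1) = 0 := by
          rw [mul_sub, sub_eq_zero]
          calc (y.2 : R) * (x.1 * z.2) = (x.1 * y.2) * z.2 := by ac_rfl
            _ = x.2 * (y.1 * z.2) := by rw [h1, mul_assoc]
            _ = y.2 * (x.2 * z.1) := by rw [h2]; ac_rfl
        exact sub_eq_zero.1 ((mul_eq_zero.1 h).resolve_left y.2.2) }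

/-- The quotient field. -/
def QuotientField : Type _ := Quotient (fracSetoid R)

namespace QuotientField

variable {R}

/-- The fraction `a / b`. -/
def frac (a : R) (b : {b : R // b ≠ 0}) : QuotientField R := Quotient.mk (fracSetoid R) (a, b)

lemma frac_eq_frac {a c : R} {b d : {b : R // b ≠ 0}} :
    frac a b = frac c d ↔ a * d = b * c :=
  Quotient.eq (r := fracSetoid R)

/-- Product of denominators. -/
def dmul (b d : {b : R // b ≠ 0}) : {b : R // b ≠ 0} := ⟨b * d, mul_ne_zero b.2 d.2⟩

lemma ind {p : QuotientField R → Prop} (h : ∀ a b, p (frac a b)) (x : QuotientField R) : p x :=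
  Quotient.ind (fun ab => h ab.1 ab.2) x

/-- `a / b + c / d = (a d + b c) / (b d)`. -/
instance : Add (QuotientField R) where
  add := Quotient.map₂ (fun x y => (x.1 * y.2 + x.2 * y.1, dmul x.2 y.2)) <| by
    rintro ⟨a, b⟩ ⟨a', b'⟩ (h1 : a * b' = b * a') ⟨c, d⟩ ⟨c', d'⟩ (h2 : c * d' = d * c')
    change (a * d + b * c) * (b' * d' : R) = (b * d : R) * (a' * d' + b' * c')
    calc (a * d + b * c) * (b' * d' : R) = (a * b') * (d * d') + (c * d') * (b * b') := by
          rw [add_mul]; congr 1 <;> ac_rfl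
      _ = (b * a') * (d * d') + (d * c') * (b * b') := by rw [h1, h2]
      _ = _ := by rw [mul_add]; congr 1 <;> ac_rfl

/-- `(a / b) (c / d) = (a c) / (b d)`. -/
instance : Mul (QuotientField R) where
  mul := Quotient.map₂ (fun x y => (x.1 * y.1, dmul x.2 y.2)) <| by
    rintro ⟨a, b⟩ ⟨a', b'⟩ (h1 : a * b' = b * a') ⟨c, d⟩ ⟨c', d'⟩ (h2 : c * d' = d * c')
    change (a * c) * (b' * d' : R) = (b * d : R) * (a' * c')
    calc (a * c) * (b' * d' : R) = (a * b') * (c * d') := by ac_rfl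
      _ = (b * a') * (d * c') := by rw [h1, h2]
      _ = _ := by ac_rfl

/-- `- (a / b) = (-a) / b`. -/
instance : Neg (QuotientField R) where
  neg := Quotient.map (fun x => (-x.1, x.2)) <| by
    rintro ⟨a, b⟩ ⟨a', b'⟩ (h1 : a * b' = b * a')
    change -a * (b' : R) = b * -a'
    rw [neg_mul, mul_neg, h1]

open Classical in
/-- `(a / b)⁻¹ = b / a` for `a ≠ 0`, and `0⁻¹ = 0`. -/
noncomputable instance : Inv (QuotientField R) where
  inv := Quotient.map (fun x => if h : x.1 = 0 then (0, x.2) else (x.2, ⟨x.1, h⟩)) <| by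
    rintro ⟨a, b⟩ ⟨a', b'⟩ (h1 : a * b' = b * a')
    by_cases ha : a = 0
    · have ha' : a' = 0 := by
        rw [ha, zero_mul] at h1
        exact (mul_eq_zero.1 h1.symm).resolve_left b.2
      simp only [ha, ha', dif_pos]
      change (0 : R) * b' = b * 0
      rw [zero_mul, mul_zero]
    · have ha' : a' ≠ 0 := by
        rintro rfl
        rw [mul_zero] at h1
        exact ha ((mul_eq_zero.1 h1).resolve_right b'.2)
      simp only [ha, ha', dif_neg, not_false_eq_true]
      change (b : R) * a' = a * b'
      exact h1.symm

lemma frac_add (a c : R) (b d : {b : R // b ≠ 0}) :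
    frac a b + frac c d = frac (a * d + b * c) (dmul b d) := rfl

lemma frac_mul (a c : R) (b d : {b : R // b ≠ 0}) :
    frac a b * frac c d = frac (a * c) (dmul b d) := rfl

lemma neg_frac (a : R) (b : {b : R // b ≠ 0}) : - frac a b = frac (-a) b := rfl

lemma inv_frac {a : R} (ha : a ≠ 0) (b : {b : R // b ≠ 0}) : (frac a b)⁻¹ = frac (b : R) ⟨a, ha⟩ := by
  refine Quotient.sound ?_
  simp only [ha, dif_neg, not_false_eq_true]
  exact (fracSetoid R).refl _

lemma inv_frac_zero (b : {b : R // b ≠ 0}) : (frac (0 : R) b)⁻¹ = frac 0 b := by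
  refine Quotient.sound ?_
  simp only [dif_pos]
  exact (fracSetoid R).refl _

variable [Nontrivial R]

variable (R) in
/-- An arbitrary nonzero element. -/
noncomputable def den : {b : R // b ≠ 0} := ⟨(exists_ne (0 : R)).choose, (exists_ne 0).choose_spec⟩

/-- `0 = 0 / b` for any `b ≠ 0`. -/
noncomputable instance : Zero (QuotientField R) := ⟨frac 0 (den R)⟩

/-- `1 = b / b` for any `b ≠ 0`. -/
noncomputable instance : One (QuotientField R) := ⟨frac (den R : R) (den R)⟩

lemma zero_eq (b : {b : R // b ≠ 0}) : (0 : QuotientField R) = frac 0 b :=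
  frac_eq_frac.2 (by rw [zero_mul, mul_zero])

lemma one_eq (b : {b : R // b ≠ 0}) : (1 : QuotientField R) = frac (b : R) b :=
  (frac_eq_frac.2 rfl : frac (den R : R) (den R) = frac (b : R) b)

lemma frac_eq_zero {a : R} {b : {b : R // b ≠ 0}} : frac a b = 0 ↔ a = 0 := by
  rw [zero_eq b, frac_eq_frac, mul_zero]
  exact ⟨fun h => (mul_eq_zero.1 h).resolve_right b.2, fun h => by rw [h, zero_mul]⟩

noncomputable instance : CommRing (QuotientField R) where
  add_assoc x y z := by
    induction x using ind with | h a b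
    induction y using ind with | h c d
    induction z using ind with | h e f
    simp only [frac_add, frac_eq_frac, dmul, add_mul, mul_add]
    simp only [mul_comm, mul_left_comm]
    abel
  add_comm x y := by
    induction x using ind with | h a b
    induction y using ind with | h c d
    simp only [frac_add, frac_eq_frac, dmul, add_mul, mul_add]
    rw [add_comm]
    congr 1 <;> ac_rfl
  zero_add x := by
    induction x using ind with | h a b
    rw [zero_eq b, frac_add, frac_eq_frac, dmul, zero_mul, zero_add]
    ac_rfl
  add_zero x := by
    induction x using ind with | h a b
    rw [zero_eq b, frac_add, frac_eq_frac, dmul, mul_zero, add_zero]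
    ac_rfl
  neg_add_cancel x := by
    induction x using ind with | h a b
    rw [neg_frac, frac_add, frac_eq_zero, neg_mul, mul_comm, neg_add_cancel]
  mul_assoc x y z := by
    induction x using ind with | h a b
    induction y using ind with | h c d
    induction z using ind with | h e f
    simp only [frac_mul, frac_eq_frac, dmul]
    ac_rfl
  mul_comm x y := by
    induction x using ind with | h a b
    induction y using ind with | h c d
    simp only [frac_mul, frac_eq_frac, dmul]
    ac_rfl
  one_mul x := by
    induction x using ind with | h a b
    rw [one_eq b, frac_mul, frac_eq_frac, dmul]
    ac_rfl
  mul_one x := by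
    induction x using ind with | h a b
    rw [one_eq b, frac_mul, frac_eq_frac, dmul]
    ac_rfl
  zero_mul x := by
    induction x using ind with | h a b
    rw [zero_eq b, frac_mul, frac_eq_frac, zero_mul, zero_mul, mul_zero]
  mul_zero x := by
    induction x using ind with | h a b
    rw [zero_eq b, frac_mul, frac_eq_frac, mul_zero, zero_mul, mul_zero]
  left_distrib x y z := by
    induction x using ind with | h a b
    induction y using ind with | h c d
    induction z using ind with | h e f
    simp only [frac_add, frac_mul, frac_eq_frac, dmul, add_mul, mul_add]
    congr 1 <;> ac_rfl
  right_distrib x y z := by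
    induction x using ind with | h a b
    induction y using ind with | h c d
    induction z using ind with | h e f
    simp only [frac_add, frac_mul, frac_eq_frac, dmul, add_mul, mul_add]
    congr 1 <;> ac_rfl
  nsmul := nsmulRec
  zsmul := zsmulRec

noncomputable instance : Field (QuotientField R) where
  exists_pair_ne := ⟨1, 0, fun h =>
    (den R).2 (frac_eq_zero.1 (show frac (den R : R) (den R) = 0 from h))⟩
  mul_inv_cancel x := by
    induction x using ind with | h a b
    intro hx
    have ha : a ≠ 0 := fun h => hx (frac_eq_zero.2 h)
    rw [inv_frac ha, frac_mul, one_eq b, frac_eq_frac]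
    change a * b * b = (b * a : R) * b
    rw [mul_comm a]
  inv_zero := inv_frac_zero (den R)
  nnqsmul := _
  nnqsmul_def _ _ := rfl
  qsmul := _
  qsmul_def _ _ := rfl

/-- The embedding of the ring into its quotient field, `a = a b / b` for any `b ≠ 0`. -/
noncomputable def embed : R →ₙ+* QuotientField R where
  toFun a := frac (a * (den R : R)) (den R)
  map_zero' := frac_eq_zero.2 (zero_mul _)
  map_add' a b := by
    rw [frac_add, frac_eq_frac, dmul]
    simp only [add_mul, mul_add]
    congr 1 <;> ac_rfl
  map_mul' a b := by
    rw [frac_mul, frac_eq_frac, dmul]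
    ac_rfl

/-- Every element is a quotient of two elements of the ring. -/
lemma frac_eq_div (a : R) (b : {b : R // b ≠ 0}) : frac a b = embed a / embed (b : R) := by
  have hb : embed (b : R) ≠ 0 := fun h =>
    mul_ne_zero b.2 (den R).2 (frac_eq_zero.1 (show frac ((b : R) * (den R : R)) (den R) = 0 from h))
  rw [eq_div_iff hb]
  change frac a b * frac ((b : R) * (den R : R)) (den R) = frac (a * (den R : R)) (den R)
  rw [frac_mul, frac_eq_frac]
  change a * (b * den R : R) * (den R : R) = (b * den R : R) * (a * den R : R)
  ac_rfl

end QuotientField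

end QuotientField

end Mikusinski

namespace Mikusinski

open scoped NNReal

/-! ### The dilation `τ_q` as a ring automorphism of the convolution ring. -/

namespace ConvRing

variable {q : ℝ} (hq : 0 < q)

/-! Everything follows from `τ_q` being an automorphism of the convolution ring, because the
quotient field depends functorially on the ring. Compatibility with convolution (`tau_mul`) is the
only analytic point. Substituting `s ↦ q s` turns the integral over `[0, qt]` into `q` times an
integral over `[0, t]`. That Jacobian and the factor `q` already in front are the two factors `q`
carried by `τ_q a` and `τ_q b`, which is why the dilation is normalised by `q`. Bijectivity holds
since `τ_{1/q}` undoes `τ_q` (`tau_tau_of_mul_eq_one`). The rest is algebra. Equality of fractions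
is the relation `a d = b c`, which any ring isomorphism preserves; injectivity keeps denominators
nonzero. So an isomorphism acts on fractions, its inverse acts inversely, and sums and products are
respected because they are given by ring expressions in numerators and denominators (`mapEquiv`).
Uniqueness needs only that every element is a quotient of ring elements (`funext_embed_div_embed`).
-/

lemma tau_apply (a : ConvRing) (t : ℝ≥0) : tau q hq a t = q * a (q.toNNReal * t) := rfl

lemma tau_add (a b : ConvRing) : tau q hq (a + b) = tau q hq a + tau q hq b := by
  ext t
  simp only [tau_apply, add_apply, mul_add]

/-- Since `q ≥ 0`, truncation at zero commutes with multiplication by `q`. The identity therefore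
holds for every real `t`, and no sign conditions arise under the convolution integral. -/
lemma extend_tau (a : ConvRing) (t : ℝ) : (tau q hq a).extend t = q * a.extend (q * t) := by
  rw [extend, extend, tau_apply, Real.toNNReal_mul hq.le]

lemma tau_mul (a b : ConvRing) : tau q hq (a * b) = tau q hq a * tau q hq b := by
  ext t
  -- The substitution `s ↦ q s` in the convolution at time `q t`; it fixes the lower endpoint `0`
  -- and supplies the second factor `q`.
  have hsub := intervalIntegral.smul_integral_comp_mul_left
    (fun s => a.extend (q * t - s) * b.extend s) q (a := 0) (b := (t : ℝ))
  rw [mul_zero] at hsub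
  rw [tau_apply, mul_eq_convR, mul_eq_convR, convR, convR, NNReal.coe_mul,
    Real.coe_toNNReal q hq.le, ← hsub, Complex.real_smul]
  simp only [extend_tau, ← intervalIntegral.integral_const_mul]
  refine intervalIntegral.integral_congr fun s _ => ?_
  simp only [mul_sub]
  ring

/-- Dilations compose by multiplying parameters, and the parameter `1` gives the identity. Taking
`{q, r} = {q, 1/q}` in either order yields both inverse laws. -/
lemma tau_tau_of_mul_eq_one {r : ℝ} (hr : 0 < r) (h : q * r = 1) (a : ConvRing) :
    tau q hq (tau r hr a) = a := by
  ext t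
  have hc : (q : ℂ) * r = 1 := by exact_mod_cast h
  have hn : r.toNNReal * q.toNNReal = 1 := by
    rw [← Real.toNNReal_mul hr.le, mul_comm, h, Real.toNNReal_one]
  rw [tau_apply, tau_apply, ← mul_assoc, ← mul_assoc, hc, hn, one_mul, one_mul]

variable (q) in
/-- The map `τ_q` as an automorphism of the convolution ring, with inverse `τ_{1/q}`. -/
noncomputable def tauEquiv : ConvRing ≃+* ConvRing where
  toFun := tau q hq
  invFun := tau q⁻¹ (inv_pos.2 hq)
  left_inv := tau_tau_of_mul_eq_one _ _ (inv_mul_cancel₀ hq.ne')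
  right_inv := tau_tau_of_mul_eq_one _ _ (mul_inv_cancel₀ hq.ne')
  map_add' := tau_add hq
  map_mul' := tau_mul hq

end ConvRing

/-! ### Functoriality of the quotient field under ring isomorphisms. -/

namespace QuotientField

variable {R S : Type*} [NonUnitalCommRing R] [NoZeroDivisors R]
  [NonUnitalCommRing S] [NoZeroDivisors S]

/-- The map `a / b ↦ e a / e b` induced by an isomorphism `e`. -/
def map (e : R ≃+* S) : QuotientField R → QuotientField S :=
  Quotient.map (fun x => (e x.1, ⟨e x.2, (map_ne_zero_iff e e.injective).2 x.2.2⟩)) <| by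
    rintro ⟨a, b⟩ ⟨c, d⟩ (h : a * d = b * c)
    -- Well-definedness: the cross-multiplication relation is purely multiplicative, so `e`
    -- transports it.
    change e a * e d = e b * e c
    rw [← map_mul, ← map_mul, h]

lemma map_frac (e : R ≃+* S) (a : R) (b : {b : R // b ≠ 0}) :
    map e (frac a b) = frac (e a) ⟨e b, (map_ne_zero_iff e e.injective).2 b.2⟩ := rfl

lemma map_symm_map (e : R ≃+* S) (x : QuotientField R) : map e.symm (map e x) = x := by
  induction x using ind with | h a b
  simp [map_frac]

variable [Nontrivial R] [Nontrivial S]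

/-- An isomorphism of rings induces an isomorphism of their quotient fields. -/
def mapEquiv (e : R ≃+* S) : QuotientField R ≃+* QuotientField S where
  toFun := map e
  invFun := map e.symm
  left_inv := map_symm_map e
  -- `e.symm.symm` agrees with `e` definitionally, so the one-sided lemma also gives the other side.
  right_inv := map_symm_map e.symm
  map_add' x y := by
    induction x using ind with | h a b
    induction y using ind with | h c d
    simp only [frac_add, map_frac, dmul, map_add, map_mul]
  map_mul' x y := by
    induction x using ind with | h a b
    induction y using ind with | h c d
    simp only [frac_mul, map_frac, dmul, map_mul]

/-- The embeddings use arbitrarily chosen denominators, and `e` need not send `den R` to `den S`.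
The two fractions thus have different representatives and are compared by cross-multiplication. -/
lemma mapEquiv_embed (e : R ≃+* S) (a : R) : mapEquiv e (embed a) = embed (e a) := by
  change frac (e (a * den R)) _ = frac (e a * den S) (den S)
  rw [frac_eq_frac]
  change e (a * den R) * (den S : S) = e (den R : R) * (e a * den S)
  rw [map_mul]
  ac_rfl

/-- A homomorphism of fields respects division, including division by zero; so `b = 0` needs no
exclusion, both sides then being `0`. -/
lemma mapEquiv_embed_div_embed (e : R ≃+* S) (a b : R) :
    mapEquiv e (embed a / embed b) = embed (e a) / embed (e b) := by
  rw [map_div₀, mapEquiv_embed, mapEquiv_embed]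

/-- A map on the quotient field is determined by its values on quotients. -/
lemma funext_embed_div_embed {X : Type*} {f g : QuotientField R → X}
    (h : ∀ a b : R, b ≠ 0 → f (embed a / embed b) = g (embed a / embed b)) : f = g := by
  funext x
  induction x using ind with | h a b
  rw [frac_eq_div]
  exact h a b b.2

end QuotientField

end Mikusinski

/-! ### The extension of `τ_q` to the quotient field. -/

open Mikusinski QuotientField in
theorem lemma3p3 (q : ℝ) (hq : 0 < q) :
    Function.Bijective (ConvRing.tau q hq) ∧
    (∀ a b : ConvRing,
      ConvRing.tau q hq (a + b) = ConvRing.tau q hq a + ConvRing.tau q hq b) ∧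
    (∀ a b : ConvRing,
      ConvRing.tau q hq (a * b) = ConvRing.tau q hq a * ConvRing.tau q hq b) ∧
    (∀ b : ConvRing, b ≠ 0 → ConvRing.tau q hq b ≠ 0) ∧
    (∀ a b c d : ConvRing, b ≠ 0 → d ≠ 0 →
      embed a / embed b = embed c / embed d →
      embed (ConvRing.tau q hq a) / embed (ConvRing.tau q hq b)
        = embed (ConvRing.tau q hq c) / embed (ConvRing.tau q hq d)) ∧
    ∃ τ : QuotientField ConvRing ≃+* QuotientField ConvRing,
      (∀ a b : ConvRing, b ≠ 0 →
        τ (embed a / embed b)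
          = embed (ConvRing.tau q hq a) / embed (ConvRing.tau q hq b)) ∧
      (∀ a : ConvRing, τ (embed a) = embed (ConvRing.tau q hq a)) ∧
      ∀ σ : QuotientField ConvRing → QuotientField ConvRing,
        (∀ a b : ConvRing, b ≠ 0 →
          σ (embed a / embed b)
            = embed (ConvRing.tau q hq a) / embed (ConvRing.tau q hq b)) →
        σ = τ := by
  have hdiv : ∀ a b : ConvRing, mapEquiv (ConvRing.tauEquiv q hq) (embed a / embed b)
      = embed (ConvRing.tau q hq a) / embed (ConvRing.tau q hq b) :=
    mapEquiv_embed_div_embed (ConvRing.tauEquiv q hq)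
  refine ⟨(ConvRing.tauEquiv q hq).bijective, ConvRing.tau_add hq, ConvRing.tau_mul hq,
    fun b hb => (map_ne_zero_iff _ (ConvRing.tauEquiv q hq).injective).2 hb,
    fun a b c d _ _ h => ?_, mapEquiv (ConvRing.tauEquiv q hq), fun a b _ => hdiv a b,
    mapEquiv_embed (ConvRing.tauEquiv q hq), fun σ hσ => ?_⟩
  -- Both sides are values of the extended map, at elements equal by `h`. This is not circular:
  -- independence of representatives was settled in `map`.
  · rw [← hdiv, ← hdiv, h]
  -- No algebraic property of `σ` is needed: the quotients with nonzero denominator exhaust the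
  -- field.
  · exact funext_embed_div_embed fun a b hb => (hσ a b hb).trans (hdiv a b).symm
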